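/- A ribbon graph $G$ is a surface with boundary that is a union of finitely many closed discs, its vertices $V(G)$ and its edges $E(G)$, such that vertices and edges meet in disjoint line segments, each segment lies on the boundary of precisely one vertex and one edge, and every edge contains exactly two segments. Let $v(H)$ be the number of vertices of a ribbon graph $H$. For $A\subseteq E(G)$ let $f(A)$ be the number of boundary components of the spanning ribbon subgraph $(V(G),A)$. The partial dual $G^{\delta(A)}$ is obtained by gluing a disc along each boundary component of $(V(G),A)$ (these discs are the new vertices), removing the interiors of the old vertices and keeping the edges. The partial Petrial $G^{\tau(A)}$ is obtained by adding a half-twist to each edge in $A$. Put $G^{\times}=G^{\tau(E(G))}$ and $G^{\tau\delta\tau(A)}=((G^{\tau(A)})^{\delta(A)})^{\tau(A)}$. For $\xi\in\{\delta,\tau\delta\tau\}$ put $$P_{\langle\xi\rangle}(G,x)=\sum_{A\subseteq E(G)}x^{v(G^{\xi(A)})}.$$ Let $D(G)=(E(G),\mathcal F(G))$ be the set system with $\mathcal F(G)=\{F\subseteq E(G): f(F)=1\}$, and $$L(G,x)=\sum_{X\subseteq E(G)}x^{d_{D(G)}(X)},\qquad d_{D(G)}(X)=\min_{F\in\mathcal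 F(G)}|X\,\Delta\,F| .$$ Theorem. Let $G$ be a connected ribbon graph (with at least one vertex). Then $\mathcal F(G)$ and $\mathcal F(G^\times)$ are non-empty, and $$P_{\langle\delta\rangle}(G,x)=x\,L(G,x),\qquad P_{\langle\tau\delta\tau\rangle}(G,x)=x\,L(G^{\times},x).$$ -/

import Mathlib

open Polynomial

universe u v

/-- A (finite) ribbon graph with edge set `E`, given by the combinatorial data of how its discs are
glued.  The marked points ("flags") are the end points of the line segments in which vertex discs
and edge discs meet.

* The boundary circle of an edge disc carries exactly four flags; they are joined alternately by
  the two line segments along which the edge is attached to vertices (`attach` sends a flag to the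
  other end of its line segment) and by the two free sides of the edge (`side` sends a flag to the
  other end of its free side).
* The boundary circle of a vertex disc carries the flags `p` with `vert p = v`; they are joined
  alternately by line segments (`attach`) and by the free arcs of the vertex boundary between
  consecutive line segments (`corner` sends a flag to the other end of its free arc).
  A vertex without flags is an isolated vertex disc.

Two ribbon graphs are equivalent exactly when these data are isomorphic, and all such data arise
from a ribbon graph; no orientability is assumed. -/
structure RibbonGraph (E : Type u) where
  /-- the set of vertex discs -/
  V : Type v
  /-- the set of end points of the common line segments of vertex discs and edge discs -/
  Flag : Type v
  finite_V : Finite V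
  finite_Flag : Finite Flag
  vert : Flag → V
  edge : Flag → E
  attach : Flag → Flag
  side : Flag → Flag
  corner : Flag → Flag
  attach_attach : ∀ p, attach (attach p) = p
  side_side : ∀ p, side (side p) = p
  corner_corner : ∀ p, corner (corner p) = p
  attach_side : ∀ p, attach (side p) = side (attach p)
  attach_ne : ∀ p, attach p ≠ p
  side_ne : ∀ p, side p ≠ p
  attach_side_ne : ∀ p, attach (side p) ≠ p
  corner_ne : ∀ p, corner p ≠ p
  edge_attach : ∀ p, edge (attach p) = edge p
  edge_side : ∀ p, edge (side p) = edge p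
  /-- every edge occurs -/
  edge_surjective : Function.Surjective edge
  /-- the flags of an edge are the four flags of a single edge disc -/
  eq_of_edge_eq : ∀ p q, edge p = edge q →
    q = p ∨ q = attach p ∨ q = side p ∨ q = attach (side p)
  vert_attach : ∀ p, vert (attach p) = vert p
  vert_corner : ∀ p, vert (corner p) = vert p
  /-- the flags of a vertex lie on a single circle -/
  eqvGen_of_vert_eq : ∀ p q, vert p = vert q →
    Relation.EqvGen (fun r s => s = attach r ∨ s = corner r) p q

namespace RibbonGraph

variable {E : Type u} [DecidableEq E]

/-- The number `v(G)` of vertices. -/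
noncomputable def vertexCount (G : RibbonGraph.{u, v} E) : ℕ := Nat.card G.V

/-- The surface is connected, i.e. the underlying graph (whose edges join the two vertices at the
two ends of a free side of an edge disc) is connected; in particular it has a vertex. -/
def Connected (G : RibbonGraph.{u, v} E) : Prop :=
  (SimpleGraph.fromRel fun x y => ∃ p, G.vert p = x ∧ G.vert (G.side p) = y).Connected

/-- The boundary of the spanning ribbon subgraph `(V(G), A)` runs from flag to flag along the free
arcs of the vertices (`corner`) and along the following arcs: the free sides of the edges in `A`,
and, at the place of an edge not in `A`, the line segments along which it was attached. -/
def boundaryStep (G : RibbonGraph.{u, v} E) (A : Finset E) (p : G.Flag) : G.Flag :=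
  if G.edge p ∈ A then G.side p else G.attach p

/-- Two flags lie on the same boundary component of the spanning ribbon subgraph `(V(G), A)`. -/
def boundarySetoid (G : RibbonGraph.{u, v} E) (A : Finset E) : Setoid G.Flag :=
  Relation.EqvGen.setoid fun p q => q = G.boundaryStep A p ∨ q = G.corner p

/-- The boundary components of the spanning ribbon subgraph `(V(G), A) = G \ Aᶜ`: those through
flags of `G`, and one for each isolated vertex disc of `G`. -/
def BoundaryComponent (G : RibbonGraph.{u, v} E) (A : Finset E) : Type v :=
  Quotient (G.boundarySetoid A) ⊕ {x : G.V // ∀ p, G.vert p ≠ x}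

/-- The number `f(G \ Aᶜ)` of boundary components (faces) of the spanning ribbon subgraph
`(V(G), A)`. -/
noncomputable def faceCount (G : RibbonGraph.{u, v} E) (A : Finset E) : ℕ :=
  Nat.card (G.BoundaryComponent A)

/-- The partial dual `G^{δ(A)}`: the vertex discs are discs glued in along the boundary components
of `(V(G), A)`, and the edge discs are kept.  So an edge in `A` is now attached along its former
free sides, and its former line segments become free sides. -/
def partialDual (G : RibbonGraph.{u, v} E) (A : Finset E) : RibbonGraph.{u, v} E where
  V := G.BoundaryComponent A
  Flag := G.Flag
  finite_V := by
    have := G.finite_V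
    have := G.finite_Flag
    unfold BoundaryComponent
    infer_instance
  finite_Flag := G.finite_Flag
  vert p := Sum.inl (Quotient.mk (G.boundarySetoid A) p)
  edge := G.edge
  attach := G.boundaryStep A
  side p := if G.edge p ∈ A then G.attach p else G.side p
  corner := G.corner
  attach_attach p := by
    by_cases h : G.edge p ∈ A <;>
      simp [boundaryStep, h, G.edge_side, G.edge_attach, G.side_side, G.attach_attach]
  side_side p := by
    by_cases h : G.edge p ∈ A <;>
      simp [h, G.edge_side, G.edge_attach, G.side_side, G.attach_attach]
  corner_corner := G.corner_corner
  attach_side p := by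
    by_cases h : G.edge p ∈ A <;>
      simp [boundaryStep, h, G.edge_side, G.edge_attach, G.attach_side]
  attach_ne p := by
    by_cases h : G.edge p ∈ A <;> simp [boundaryStep, h, G.side_ne, G.attach_ne]
  side_ne p := by
    by_cases h : G.edge p ∈ A <;> simp [h, G.side_ne, G.attach_ne]
  attach_side_ne p := by
    have h1 := G.attach_side_ne p
    have h2 := G.attach_side p
    by_cases h : G.edge p ∈ A
    · simpa [boundaryStep, h, G.edge_attach, ← h2] using h1
    · simpa [boundaryStep, h, G.edge_side] using h1
  corner_ne := G.corner_ne
  edge_attach p := by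
    by_cases h : G.edge p ∈ A <;> simp [boundaryStep, h, G.edge_side, G.edge_attach]
  edge_side p := by
    by_cases h : G.edge p ∈ A <;> simp [h, G.edge_side, G.edge_attach]
  edge_surjective := G.edge_surjective
  eq_of_edge_eq p q hpq := by
    have h2 := G.attach_side p
    have h3 := G.eq_of_edge_eq p q hpq
    by_cases h : G.edge p ∈ A
    · simp only [boundaryStep, h, G.edge_attach, if_true, ← h2]
      tauto
    · simp only [boundaryStep, h, G.edge_side, if_false]
      tauto
  vert_attach p := congrArg Sum.inl <| Quotient.sound <|
    Relation.EqvGen.symm _ _ (Relation.EqvGen.rel _ _ (Or.inl rfl))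
  vert_corner p := congrArg Sum.inl <| Quotient.sound <|
    Relation.EqvGen.symm _ _ (Relation.EqvGen.rel _ _ (Or.inr rfl))
  eqvGen_of_vert_eq _ _ h := Quotient.exact (Sum.inl_injective h)

/-- The partial Petrial `G^{τ(A)}`: a half-twist is added to each edge in `A`.  The half-twist
exchanges, at one of the two ends of the edge, the flags to which the two free sides lead. -/
def partialPetrial (G : RibbonGraph.{u, v} E) (A : Finset E) : RibbonGraph.{u, v} E where
  V := G.V
  Flag := G.Flag
  finite_V := G.finite_V
  finite_Flag := G.finite_Flag
  vert := G.vert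
  edge := G.edge
  attach := G.attach
  side p := if G.edge p ∈ A then G.attach (G.side p) else G.side p
  corner := G.corner
  attach_attach := G.attach_attach
  side_side p := by
    by_cases h : G.edge p ∈ A <;>
      simp [h, G.edge_side, G.edge_attach, G.side_side, G.attach_attach, G.attach_side]
  corner_corner := G.corner_corner
  attach_side p := by
    by_cases h : G.edge p ∈ A <;> simp [h, G.edge_attach, G.attach_side]
  attach_ne := G.attach_ne
  side_ne p := by
    by_cases h : G.edge p ∈ A <;> simp [h, G.side_ne, G.attach_side_ne]
  attach_side_ne p := by
    by_cases h : G.edge p ∈ A <;> simp [h, G.side_ne, G.attach_side_ne, G.attach_attach]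
  corner_ne := G.corner_ne
  edge_attach := G.edge_attach
  edge_side p := by
    by_cases h : G.edge p ∈ A <;> simp [h, G.edge_side, G.edge_attach]
  edge_surjective := G.edge_surjective
  eq_of_edge_eq p q hpq := by
    have h3 := G.eq_of_edge_eq p q hpq
    by_cases h : G.edge p ∈ A
    · simp only [h, if_true, G.attach_attach]
      tauto
    · simp only [h, if_false]
      tauto
  vert_attach := G.vert_attach
  vert_corner := G.vert_corner
  eqvGen_of_vert_eq := G.eqvGen_of_vert_eq

/-- The Petrie dual `G^× = G^{τ(E(G))}`. -/
def petrial [Fintype E] (G : RibbonGraph.{u, v} E) : RibbonGraph.{u, v} E :=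
  G.partialPetrial Finset.univ

/-- The two letters `δ` and `τ`. -/
inductive Op
  | δ
  | τ

/-- `G^{w(A)}` for a word `w = w₁ w₂ ⋯ wₙ` in `δ` and `τ`; the last letter acts first. -/
def twist (G : RibbonGraph.{u, v} E) (A : Finset E) : List Op → RibbonGraph.{u, v} E
  | [] => G
  | Op.δ :: w => (G.twist A w).partialDual A
  | Op.τ :: w => (G.twist A w).partialPetrial A

/-- The vertex polynomial `P_{⟨ξ⟩}(G, x) = ∑_{A ⊆ E(G)} x^{v(G^{ξ(A)})}` for a word `ξ` of order two
(`δ`, `τ` or `τδτ`): the orbit `(G^{ξ(A)})_A` is summed over as a family indexed by the subsets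
`A` of `E(G)`. -/
noncomputable def vertexPolynomial [Fintype E] (ξ : List Op) (G : RibbonGraph.{u, v} E) : ℤ[X] :=
  ∑ A : Finset E, X ^ (G.twist A ξ).vertexCount

end RibbonGraph

/-- A set system on the ground set `E`. -/
structure SetSystem (E : Type u) where
  feasible : Set (Finset E)

namespace SetSystem

variable {E : Type u} [DecidableEq E]

/-- A set system is proper if it has a feasible set. -/
def Proper (D : SetSystem E) : Prop := D.feasible.Nonempty

/-- The distance `d_D(X) = min_{F feasible} |X Δ F|` (for a proper set system `D`). -/
noncomputable def distance (D : SetSystem E) (X : Finset E) : ℕ :=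
  sInf {n | ∃ F ∈ D.feasible, (symmDiff X F).card = n}

/-- The interlace polynomial `L(D, x) = ∑_{X ⊆ E} x^{d_D(X)}`. -/
noncomputable def interlacePolynomial [Fintype E] (D : SetSystem E) : ℤ[X] :=
  ∑ A : Finset E, X ^ D.distance A

end SetSystem

namespace RibbonGraph

variable {E : Type u} [DecidableEq E]

/-- The delta-matroid `D(G)`: the feasible sets are the `F ⊆ E(G)` for which the spanning ribbon
subgraph `(V(G), F)` has exactly one boundary component. -/
def deltaMatroid (G : RibbonGraph.{u, v} E) : SetSystem E where
  feasible := {F | G.faceCount F = 1}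

/-- The interlace polynomial `L(G, x) = L(D(G), x)` of a ribbon graph. -/
noncomputable def interlacePolynomial [Fintype E] (G : RibbonGraph.{u, v} E) : ℤ[X] :=
  G.deltaMatroid.interlacePolynomial

end RibbonGraph

/-! By construction the vertices of `G^{δ(A)}` are the boundary components of `(V(G), A)`, so the
first identity amounts to `f(A) = d(A) + 1` for every `A`. Toggling an edge in `A` only reconnects
the at most two components that meet it, so `f` changes by at most one; hence `f(A) ≤ 1 + |A Δ F|`
for feasible `F` (`faceCount_le_add_card_symmDiff`). Conversely, toggling an edge that meets two
components joins them (`faceCount_symmDiff_lt`), and if no edge does so, connectedness forces `f(A)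
= 1`. Repeated toggling thus reaches a feasible set in at most `f(A) - 1` moves
(`Connected.exists_feasible`). For `τδτ`, the boundary of `(V(G), A)` does not see twists outside
`A`, so `G^{τ(A)}` may be replaced by `G^×`. -/

namespace Setoid

/-! ### Counting classes of equivalence relations -/

variable {α : Type*}

theorem card_quotient_le_of_le [Finite α] {r s : Setoid α} (h : r ≤ s) :
    Nat.card (Quotient s) ≤ Nat.card (Quotient r) :=
  Nat.card_le_card_of_surjective (Quotient.map' id h) fun y => by
    induction y using Quotient.inductionOn with
    | h a => exact ⟨Quotient.mk r a, rfl⟩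

theorem card_quotient_lt_of_le [Finite α] {r s : Setoid α} (h : r ≤ s) {p q : α}
    (hs : s p q) (hr : ¬ r p q) : Nat.card (Quotient s) < Nat.card (Quotient r) := by
  refine lt_of_le_of_ne (card_quotient_le_of_le h) fun heq => hr ?_
  have hsurj : Function.Surjective (Quotient.map' id h : Quotient r → Quotient s) := fun y => by
    induction y using Quotient.inductionOn with
    | h a => exact ⟨Quotient.mk r a, rfl⟩
  have hbij := (Nat.bijective_iff_surjective_and_card _).2 ⟨hsurj, heq.symm⟩
  exact Quotient.exact (s := r) (hbij.1 (a₁ := Quotient.mk r p) (a₂ := Quotient.mk r q)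
    (Quotient.sound (s := s) hs))

open Classical in
/-- The equivalence relation obtained from `r` by joining the classes of `p` and `q`. -/
noncomputable def merge (r : Setoid α) (p q : α) : Setoid α :=
  Setoid.ker fun x => if r x q then Quotient.mk r p else Quotient.mk r x

open Classical in
theorem merge_iff (r : Setoid α) (p q x y : α) : r.merge p q x y ↔
    (if r x q then Quotient.mk r p else Quotient.mk r x) =
      if r y q then Quotient.mk r p else Quotient.mk r y := Iff.rfl

theorem le_merge (r : Setoid α) (p q : α) : r ≤ r.merge p q := by
  intro x y h
  have hq : r x q ↔ r y q := ⟨fun h' => r.trans (r.symm h) h', fun h' => r.trans h h'⟩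
  have hm : Quotient.mk r x = Quotient.mk r y := Quotient.sound h
  rw [merge_iff, hm]
  by_cases h' : r x q
  · rw [if_pos h', if_pos (hq.1 h')]
  · rw [if_neg h', if_neg (mt hq.2 h')]

theorem merge_rel (r : Setoid α) (p q : α) : r.merge p q p q := by
  rw [merge_iff, if_pos (r.refl q), ite_self]

theorem card_quotient_le_merge [Finite α] (r : Setoid α) (p q : α) :
    Nat.card (Quotient r) ≤ Nat.card (Quotient (r.merge p q)) + 1 := by
  classical
  rw [← Finite.card_option]
  -- Merging loses at most the class of `q`, which `none` records.
  refine Nat.card_le_card_of_injective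
    (fun c : Quotient r => if c = Quotient.mk r q then none else
      some (Quotient.map' id (le_merge r p q) c)) ?_
  intro a b
  induction a using Quotient.inductionOn with
  | h x =>
  induction b using Quotient.inductionOn with
  | h y =>
  by_cases hx : Quotient.mk r x = Quotient.mk r q <;>
    by_cases hy : Quotient.mk r y = Quotient.mk r q
  · intro _; rw [hx, hy]
  · simp [hx, hy]
  · simp [hx, hy]
  · simp only [hx, hy, if_false, Option.some.injEq]
    intro h
    have h' : r.merge p q x y := Quotient.exact h
    have hx' : ¬ r x q := fun h => hx (Quotient.sound h)
    have hy' : ¬ r y q := fun h => hy (Quotient.sound h)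
    rwa [merge_iff, if_neg hx', if_neg hy'] at h'

end Setoid

theorem Finset.even_card_of_involution {α : Type*} (s : Finset α) (g : α → α)
    (hmem : ∀ a ∈ s, g a ∈ s) (hg : ∀ a, g (g a) = a) (hne : ∀ a, g a ≠ a) : Even s.card := by
  have h : ∑ _a ∈ s, (1 : ZMod 2) = 0 :=
    Finset.sum_involution (fun a _ => g a) (fun _ _ => by decide) (fun a _ _ => hne a) hmem
      fun a _ => hg a
  rw [Finset.sum_const, nsmul_one] at h
  exact even_iff_two_dvd.2 ((ZMod.natCast_eq_zero_iff _ _).1 h)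

/-! ### Toggling one edge -/

namespace RibbonGraph

variable {E : Type u} [DecidableEq E] (G : RibbonGraph.{u, v} E)

/-- The involution complementary to `boundaryStep`: the free sides of the edge discs in the partial
dual `G.partialDual A`. -/
def coboundaryStep (A : Finset E) : G.Flag → G.Flag := (G.partialDual A).side

theorem edge_boundaryStep (A : Finset E) (p : G.Flag) :
    G.edge (G.boundaryStep A p) = G.edge p := (G.partialDual A).edge_attach p

theorem boundaryStep_symmDiff_of_eq (A : Finset E) {e : E} {x : G.Flag} (h : G.edge x = e) :
    G.boundaryStep (symmDiff A {e}) x = G.coboundaryStep A x := by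
  by_cases hA : e ∈ A <;> simp [boundaryStep, coboundaryStep, partialDual, h, Finset.mem_symmDiff, hA]

theorem boundaryStep_symmDiff_of_ne (A : Finset E) {e : E} {x : G.Flag} (h : G.edge x ≠ e) :
    G.boundaryStep (symmDiff A {e}) x = G.boundaryStep A x := by
  simp [boundaryStep, h, Finset.mem_symmDiff]

theorem boundarySetoid_step (A : Finset E) (p : G.Flag) :
    G.boundarySetoid A p (G.boundaryStep A p) := Relation.EqvGen.rel _ _ (Or.inl rfl)

theorem boundarySetoid_corner (A : Finset E) (p : G.Flag) :
    G.boundarySetoid A p (G.corner p) := Relation.EqvGen.rel _ _ (Or.inr rfl)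

theorem boundarySetoid_le {A : Finset E} {s : Setoid G.Flag}
    (hstep : ∀ p, s p (G.boundaryStep A p)) (hcorner : ∀ p, s p (G.corner p)) :
    G.boundarySetoid A ≤ s := by
  refine Setoid.eqvGen_le ?_
  rintro p q (rfl | rfl)
  exacts [hstep p, hcorner p]

/-- An equivalence relation that relates `p` to its images under `boundaryStep`, `coboundaryStep`
and their composite relates `p` to all flags of its edge. -/
theorem rel_of_edge_eq (A : Finset E) {s : Setoid G.Flag} {p : G.Flag}
    (h₁ : s p (G.boundaryStep A p)) (h₂ : s p (G.coboundaryStep A p))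
    (h₃ : s p (G.boundaryStep A (G.coboundaryStep A p))) {q : G.Flag}
    (hq : G.edge p = G.edge q) : s p q := by
  rcases (G.partialDual A).eq_of_edge_eq p q hq with h | h | h | h
  · exact h ▸ s.refl p
  · exact h ▸ h₁
  · exact h ▸ h₂
  · exact h ▸ h₃

theorem boundarySetoid_symmDiff_le {A : Finset E} {s : Setoid G.Flag}
    (hs : G.boundarySetoid A ≤ s) {p : G.Flag} (h : ∀ q, G.edge p = G.edge q → s p q) :
    G.boundarySetoid (symmDiff A {G.edge p}) ≤ s := by
  refine G.boundarySetoid_le (fun x => ?_) fun x => hs (G.boundarySetoid_corner A x)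
  by_cases hx : G.edge x = G.edge p
  · exact s.trans (s.symm (h x hx.symm)) (h _ (by rw [edge_boundaryStep, hx]))
  · rw [G.boundaryStep_symmDiff_of_ne A hx]
    exact hs (G.boundarySetoid_step A x)

theorem faceCount_eq (A : Finset E) : G.faceCount A =
    Nat.card (Quotient (G.boundarySetoid A)) + Nat.card {x : G.V // ∀ p, G.vert p ≠ x} := by
  have := G.finite_V
  have := G.finite_Flag
  exact Nat.card_sum

/-- The boundary of `(V(G), A)` meets the four flags of `e` in two arcs. Merging their classes costs
at most one class and gives a relation coarser than both boundary relations. -/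
theorem faceCount_le_symmDiff_singleton (A : Finset E) (e : E) :
    G.faceCount A ≤ G.faceCount (symmDiff A {e}) + 1 := by
  have := G.finite_Flag
  obtain ⟨p, rfl⟩ := G.edge_surjective e
  set r := G.boundarySetoid A
  set s := r.merge p (G.coboundaryStep A p)
  have hrs : r ≤ s := r.le_merge _ _
  have h₂ : s p (G.coboundaryStep A p) := r.merge_rel _ _
  have hle : G.boundarySetoid (symmDiff A {G.edge p}) ≤ s :=
    G.boundarySetoid_symmDiff_le hrs fun q hq => G.rel_of_edge_eq A
      (hrs (G.boundarySetoid_step A p)) h₂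
      (s.trans h₂ (hrs (G.boundarySetoid_step A _))) hq
  have h₃ : Nat.card (Quotient r) ≤ Nat.card (Quotient s) + 1 := r.card_quotient_le_merge _ _
  have h₄ := Setoid.card_quotient_le_of_le hle
  rw [faceCount_eq, faceCount_eq]
  change Nat.card (Quotient r) + _ ≤ _
  omega

theorem faceCount_le_add_card_symmDiff (A F : Finset E) :
    G.faceCount A ≤ G.faceCount F + (symmDiff A F).card := by
  obtain ⟨B, hB⟩ : ∃ B, B = symmDiff A F := ⟨_, rfl⟩
  obtain rfl : F = symmDiff A B := by rw [hB, symmDiff_symmDiff_cancel_left]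
  rw [symmDiff_symmDiff_cancel_left]
  clear hB
  induction B using Finset.induction_on with
  | empty => exact (congrArg G.faceCount (symmDiff_bot A)).ge
  | insert e B he ih =>
    have h : insert e B = symmDiff B {e} := by
      ext x
      by_cases hx : x = e
      · subst hx; simp [Finset.mem_symmDiff, he]
      · simp [Finset.mem_symmDiff, hx]
    have h₁ := G.faceCount_le_symmDiff_singleton (symmDiff A B) e
    rw [symmDiff_assoc, ← h] at h₁
    rw [Finset.card_insert_of_notMem he]
    omega

/-- If an edge meets two distinct boundary components, then toggling it keeps the two ends of the
removed arc on the same boundary component. -/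
theorem boundarySetoid_symmDiff_of_not_rel (A : Finset E) {p : G.Flag}
    (hp : ¬ G.boundarySetoid A p (G.coboundaryStep A p)) :
    G.boundarySetoid (symmDiff A {G.edge p}) p (G.boundaryStep A p) := by
  classical
  have := G.finite_Flag
  have := Fintype.ofFinite G.Flag
  by_contra hcon
  set r := G.boundarySetoid A with hr
  set s := G.boundarySetoid (symmDiff A {G.edge p}) with hs
  -- Parity argument: if the claim fails, `p` is the only flag of its edge in `C`. Then `corner`
  -- pairs off `C`, while `boundaryStep A` pairs off `C` without `p`.
  let C : Finset G.Flag := {q | r p q ∧ s p q}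
  have hC : ∀ q, q ∈ C ↔ r p q ∧ s p q := fun q => by simp [C]
  have hpC : p ∈ C := (hC p).2 ⟨r.refl p, s.refl p⟩
  have hedge : ∀ q ∈ C, G.edge q = G.edge p → q = p := by
    intro q hq hqe
    obtain ⟨h₁, h₂⟩ := (hC q).1 hq
    rcases (G.partialDual A).eq_of_edge_eq p q hqe.symm with h | h | h | h
    · exact h
    · exact absurd (by rwa [h] at h₂) hcon
    · exact absurd (by rwa [h] at h₁) hp
    · refine absurd (r.trans h₁ (r.symm ?_)) hp
      rw [h]
      exact G.boundarySetoid_step A _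
  have heven : Even C.card := Finset.even_card_of_involution C G.corner
    (fun q hq => (hC _).2 ⟨r.trans ((hC q).1 hq).1 (G.boundarySetoid_corner _ q),
      s.trans ((hC q).1 hq).2 (G.boundarySetoid_corner _ q)⟩) G.corner_corner G.corner_ne
  have hodd : Even (C.erase p).card := by
    refine Finset.even_card_of_involution _ (G.boundaryStep A) (fun q hq => ?_)
      (G.partialDual A).attach_attach (G.partialDual A).attach_ne
    obtain ⟨hqp, hq⟩ := Finset.mem_erase.1 hq
    have hqe : G.edge q ≠ G.edge p := fun h => hqp (hedge q hq h)
    refine Finset.mem_erase.2 ⟨fun h => hqe ?_, (hC _).2 ⟨?_, ?_⟩⟩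
    · rw [← h, edge_boundaryStep]
    · exact r.trans ((hC q).1 hq).1 (G.boundarySetoid_step A q)
    · rw [← G.boundaryStep_symmDiff_of_ne A hqe]
      exact s.trans ((hC q).1 hq).2 (G.boundarySetoid_step _ q)
  rw [← Finset.card_erase_add_one hpC] at heven
  exact (Nat.even_add_one.1 heven) hodd

/-- After toggling, all four flags of the edge share a component, so the new relation contains the
old one, strictly because of `hp`. -/
theorem faceCount_symmDiff_lt (A : Finset E) {p : G.Flag}
    (hp : ¬ G.boundarySetoid A p (G.coboundaryStep A p)) :
    G.faceCount (symmDiff A {G.edge p}) < G.faceCount A := by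
  have := G.finite_Flag
  set B := symmDiff A {G.edge p} with hB
  set s := G.boundarySetoid B with hs
  have hstep : ∀ x, G.edge x = G.edge p → s x (G.coboundaryStep A x) := fun x hx => by
    rw [← G.boundaryStep_symmDiff_of_eq A hx]
    exact G.boundarySetoid_step B x
  have h₁ : s p (G.boundaryStep A p) := G.boundarySetoid_symmDiff_of_not_rel A hp
  have h₃ : s p (G.boundaryStep A (G.coboundaryStep A p)) := by
    have h := hstep (G.boundaryStep A p) (G.edge_boundaryStep A p)
    have hcomm : G.boundaryStep A (G.coboundaryStep A p) =
        G.coboundaryStep A (G.boundaryStep A p) := (G.partialDual A).attach_side p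
    rw [hcomm]
    exact s.trans h₁ h
  have hle : G.boundarySetoid A ≤ s := by
    have h := G.boundarySetoid_symmDiff_le (A := B) (s := s) le_rfl (p := p) fun q hq =>
      G.rel_of_edge_eq A h₁ (hstep p rfl) h₃ hq
    rwa [hB, symmDiff_symmDiff_cancel_right] at h
  have h := Setoid.card_quotient_lt_of_le hle (hstep p rfl) hp
  rw [faceCount_eq, faceCount_eq]
  exact Nat.add_lt_add_right h _

/-! ### Connected ribbon graphs and the distance to feasible sets -/

variable {G}

-- Follows a walk from `x` to `y`. The alternative `x = y` covers an isolated vertex, which has no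
-- flags.
omit [DecidableEq E] in
theorem Connected.exists_flags (hG : G.Connected) {s : Setoid G.Flag}
    (hattach : ∀ p, s p (G.attach p)) (hside : ∀ p, s p (G.side p))
    (hcorner : ∀ p, s p (G.corner p)) (x y : G.V) :
    x = y ∨ ∃ p q, G.vert p = x ∧ G.vert q = y ∧ s p q := by
  have hvert : ∀ p q, G.vert p = G.vert q → s p q := by
    intro p q h
    refine (Setoid.eqvGen_le (s := s) ?_) (G.eqvGen_of_vert_eq p q h)
    rintro a b (rfl | rfl)
    exacts [hattach a, hcorner a]
  obtain ⟨w⟩ := hG.preconnected x y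
  induction w with
  | nil => exact Or.inl rfl
  | cons hadj _ ih =>
    right
    obtain ⟨p, q, hp, hq, hpq⟩ : ∃ p q, G.vert p = _ ∧ G.vert q = _ ∧ s p q := by
      rcases ((SimpleGraph.fromRel_adj _ _ _).1 hadj).2 with ⟨p, h₁, h₂⟩ | ⟨p, h₁, h₂⟩
      · exact ⟨p, G.side p, h₁, h₂, hside p⟩
      · exact ⟨G.side p, p, h₂, h₁, s.symm (hside p)⟩
    rcases ih with rfl | ⟨p', q', hp', hq', h'⟩
    · exact ⟨p, q, hp, hq, hpq⟩
    · exact ⟨p, q', hp, hq', s.trans hpq (s.trans (hvert _ _ (hq.trans hp'.symm)) h')⟩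

omit [DecidableEq E] in
theorem Connected.rel (hG : G.Connected) {s : Setoid G.Flag}
    (hattach : ∀ p, s p (G.attach p)) (hside : ∀ p, s p (G.side p))
    (hcorner : ∀ p, s p (G.corner p)) (p q : G.Flag) : s p q := by
  have hvert : ∀ p q, G.vert p = G.vert q → s p q := by
    intro p q h
    refine (Setoid.eqvGen_le (s := s) ?_) (G.eqvGen_of_vert_eq p q h)
    rintro a b (rfl | rfl)
    exacts [hattach a, hcorner a]
  rcases hG.exists_flags hattach hside hcorner (G.vert p) (G.vert q) with h | ⟨a, b, ha, hb, h⟩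
  · exact hvert p q h
  · exact s.trans (hvert p a ha.symm) (s.trans h (hvert b q hb))

theorem Connected.faceCount_pos (hG : G.Connected) (A : Finset E) : 0 < G.faceCount A := by
  have := G.finite_V
  have := G.finite_Flag
  have : Finite (G.BoundaryComponent A) := (G.partialDual A).finite_V
  have : Nonempty (G.BoundaryComponent A) := by
    obtain ⟨x⟩ := hG.nonempty
    by_cases h : ∀ p, G.vert p ≠ x
    · exact ⟨Sum.inr ⟨x, h⟩⟩
    · push Not at h
      exact ⟨(G.partialDual A).vert h.choose⟩
  exact Nat.card_pos

theorem Connected.faceCount_eq_one (hG : G.Connected) {A : Finset E}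
    (h : ∀ p, G.boundarySetoid A p (G.coboundaryStep A p)) : G.faceCount A = 1 := by
  set s := G.boundarySetoid A
  have hattach : ∀ p, s p (G.attach p) := by
    intro p
    by_cases hp : G.edge p ∈ A
    · simpa [coboundaryStep, partialDual, hp] using h p
    · simpa [boundaryStep, hp] using G.boundarySetoid_step A p
  have hside : ∀ p, s p (G.side p) := by
    intro p
    by_cases hp : G.edge p ∈ A
    · simpa [boundaryStep, hp] using G.boundarySetoid_step A p
    · simpa [coboundaryStep, partialDual, hp] using h p
  have hcorner := G.boundarySetoid_corner A
  refine le_antisymm ?_ (hG.faceCount_pos A)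
  have : Finite (G.BoundaryComponent A) := (G.partialDual A).finite_V
  refine Finite.card_le_one_iff_subsingleton.2 ⟨?_⟩
  -- By connectedness, an isolated vertex disc excludes all flags.
  have hmixed : ∀ (p : G.Flag) (x : {x : G.V // ∀ p, G.vert p ≠ x}), False := by
    rintro p ⟨x, hx⟩
    rcases hG.exists_flags hattach hside hcorner x (G.vert p) with h | ⟨a, -, ha, -⟩
    exacts [hx p h.symm, hx a ha]
  rintro (c | x) (d | y)
  · induction c using Quotient.inductionOn with
    | h p =>
    induction d using Quotient.inductionOn with
    | h q => exact congrArg Sum.inl (Quotient.sound (hG.rel hattach hside hcorner p q))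
  · exact (hmixed c.out y).elim
  · exact (hmixed d.out x).elim
  · rcases hG.exists_flags hattach hside hcorner x y with h | ⟨a, -, ha, -⟩
    exacts [congrArg Sum.inr (Subtype.ext h), (x.2 a ha).elim]

theorem Connected.exists_feasible (hG : G.Connected) (A : Finset E) :
    ∃ F, G.faceCount F = 1 ∧ (symmDiff A F).card + 1 ≤ G.faceCount A := by
  induction hn : G.faceCount A using Nat.strong_induction_on generalizing A with
  | _ n ih =>
    subst hn
    by_cases h : ∀ p, G.boundarySetoid A p (G.coboundaryStep A p)
    · exact ⟨A, hG.faceCount_eq_one h, by simp [hG.faceCount_eq_one h]⟩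
    · push Not at h
      obtain ⟨p, hp⟩ := h
      have hlt := G.faceCount_symmDiff_lt A hp
      obtain ⟨F, hF, hle⟩ := ih _ hlt _ rfl
      refine ⟨F, hF, ?_⟩
      -- The triangle inequality: one toggle adds at most one to the distance and lowers `f` by at
      -- least one.
      have h₁ : symmDiff A F ⊆ symmDiff A (symmDiff A {G.edge p}) ∪
          symmDiff (symmDiff A {G.edge p}) F := symmDiff_triangle _ _ _
      rw [symmDiff_symmDiff_cancel_left] at h₁
      have h₂ := (Finset.card_le_card h₁).trans (Finset.card_union_le _ _)
      rw [Finset.card_singleton] at h₂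
      omega

theorem Connected.distance_add_one (hG : G.Connected) (A : Finset E) :
    G.deltaMatroid.distance A + 1 = G.faceCount A := by
  obtain ⟨F, hF, hle⟩ := hG.exists_feasible A
  have h₁ : G.deltaMatroid.distance A ≤ (symmDiff A F).card := Nat.sInf_le ⟨F, hF, rfl⟩
  -- The minimum is attained since a feasible set exists, so the value `sInf ∅ = 0` plays no role.
  obtain ⟨F', hF', h₂⟩ := Nat.sInf_mem (s := {n | ∃ F ∈ G.deltaMatroid.feasible,
    (symmDiff A F).card = n}) ⟨_, F, hF, rfl⟩
  have h₃ := G.faceCount_le_add_card_symmDiff A F'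
  have h₄ : G.faceCount F' = 1 := hF'
  have h₅ : (symmDiff A F').card = G.deltaMatroid.distance A := h₂
  omega

theorem Connected.proper_deltaMatroid (hG : G.Connected) : G.deltaMatroid.Proper := by
  obtain ⟨F, hF, -⟩ := hG.exists_feasible ∅
  exact ⟨F, hF⟩

theorem Connected.sum_faceCount [Fintype E] (hG : G.Connected) :
    ∑ A : Finset E, (X : ℤ[X]) ^ G.faceCount A = X * G.interlacePolynomial := by
  simp only [interlacePolynomial, SetSystem.interlacePolynomial, Finset.mul_sum, ← pow_succ',
    hG.distance_add_one]

theorem Connected.petrial [Fintype E] (hG : G.Connected) : G.petrial.Connected := by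
  have h : ∀ p, G.petrial.vert (G.petrial.side p) = G.vert (G.side p) := fun p => by
    simp [RibbonGraph.petrial, partialPetrial, G.vert_attach]
  unfold Connected
  simp only [h]
  exact hG

/-- Free sides are traversed only on edges in `A`, which are twisted in both graphs; other edges
enter through `attach`, which twists preserve. -/
theorem faceCount_partialPetrial [Fintype E] (G : RibbonGraph.{u, v} E) (A : Finset E) :
    (G.partialPetrial A).faceCount A = G.petrial.faceCount A := by
  have h : (G.partialPetrial A).boundaryStep A = G.petrial.boundaryStep A := by
    funext p
    by_cases hp : G.edge p ∈ A <;> simp [boundaryStep, RibbonGraph.petrial, partialPetrial, hp]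
  have hs : (G.partialPetrial A).boundarySetoid A = G.petrial.boundarySetoid A := by
    unfold boundarySetoid
    rw [h]
    rfl
  rw [faceCount_eq, faceCount_eq, hs]
  rfl

end RibbonGraph

theorem mainTheorem5 {E : Type u} [Fintype E] [DecidableEq E] (G : RibbonGraph.{u, v} E)
    (hG : G.Connected) :
    (G.deltaMatroid.Proper ∧ G.petrial.deltaMatroid.Proper) ∧
    G.vertexPolynomial [RibbonGraph.Op.δ] = X * G.interlacePolynomial ∧
    G.vertexPolynomial [RibbonGraph.Op.τ, RibbonGraph.Op.δ, RibbonGraph.Op.τ] =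
      X * G.petrial.interlacePolynomial := by
  -- `vertexCount` of a partial dual is `faceCount` by definition; the outer `τ` keeps the vertex
  -- set.
  refine ⟨⟨hG.proper_deltaMatroid, hG.petrial.proper_deltaMatroid⟩, hG.sum_faceCount, ?_⟩
  rw [← hG.petrial.sum_faceCount]
  exact Finset.sum_congr rfl fun A _ =>
    congrArg (fun n => (X : ℤ[X]) ^ n) (G.faceCount_partialPetrial A)
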